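/- Let $\mathbf{k}$ be a field and let $P=\mathbb{Z}$ (respectively $P=\mathbb{N}=\{0,1,2,\dots\}$). Order $P^2$ by $s\le t \iff s_x\le t_x$ and $s_y\le t_y$. A *bimodule indexed over $P^2$* is a functor $M$ from the poset $(P^2,\le)$ to $\mathbf{k}$-vector spaces, with spaces $M_t$ and maps $\rho_s^t:M_s\to M_t$ for $s\le t$. It is *pointwise finite-dimensional (pfd)* if every $M_t$ is finite-dimensional, and *exact* if for all $s\le t$ in $P^2$ the sequence $$M_s \xrightarrow{\ \phi=(\rho_s^{(t_x,s_y)},\,\rho_s^{(s_x,t_y)})\ } M_{(t_x,s_y)}\oplus M_{(s_x,t_y)} \xrightarrow{\ \psi=\rho_{(t_x,s_y)}^{t}-\rho_{(s_x,t_y)}^{t}\ } M_t$$ satisfies $\operatorname{Im}\phi=\operatorname{Ker}\psi$. Each real $x$ gives two decorated reals $x^\downarrow, x^\uparrow$, ordered so that $x^\downarrow<x<x^\uparrow<y^\downarrow<y<y^\uparrow$ for all reals $x<y$; also allow $\pm\infty$ as decorated values. For decorated values $a,b$, a *block* in $\mathbb{R}^2$ is one of the sets $\{t: a\le t_x,\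 b\le t_y\}$ (birth quadrant), $\{t: t_x\le a,\ t_y\le b\}$ (death quadrant), $\{t: a\le t_y\le b\}$ (horizontal band), $\{t: a\le t_x\le b\}$ (vertical band). The *block module* over $P^2$ of a block $B$ has the space $\mathbf{k}$ at every $t\in B\cap P^2$ and zero elsewhere; its map from $s$ to $t$ is the identity if $s,t\in B\cap P^2$, and zero otherwise. **Theorem.** Every exact pfd bimodule indexed over $\mathbb{Z}^2$ (respectively $\mathbb{N}^2$) is isomorphic to the direct sum of a family of block modules over $\mathbb{Z}^2$ (respectively $\mathbb{N}^2$). -/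

import Mathlib

open CategoryTheory
open scoped DirectSum

universe u v w

/-- Points of `P × P`, with coordinates `x` and `y`. -/
@[ext]
structure Point (P : Type w) where
  x : P
  y : P

/-- The product order: `s ≤ t` iff `s.x ≤ t.x` and `s.y ≤ t.y`. -/
instance Point.instPartialOrder {P : Type w} [PartialOrder P] : PartialOrder (Point P) where
  le s t := s.x ≤ t.x ∧ s.y ≤ t.y
  le_refl _ := ⟨le_refl _, le_refl _⟩
  le_trans _ _ _ h h' := ⟨h.1.trans h'.1, h.2.trans h'.2⟩
  le_antisymm _ _ h h' := Point.ext (h.1.antisymm h'.1) (h.2.antisymm h'.2)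

/-- A persistence bimodule indexed over `P × P`: a functor from the poset `P × P` (with the product
order) to the category of `k`-vector spaces. -/
abbrev Bimodule (P : Type w) [PartialOrder P] (k : Type u) [Field k] :=
  Point P ⥤ ModuleCat.{v} k

namespace Bimodule

section Basic

variable {P : Type w} [PartialOrder P] {k : Type u} [Field k]

/-- The structure map `M_s → M_t` for `s ≤ t`. -/
def rho (M : Bimodule.{u, v, w} P k) {s t : Point P} (h : s ≤ t) : M.obj s →ₗ[k] M.obj t :=
  (M.map (homOfLE h)).hom

/-- Pointwise finite-dimensional. -/
def IsPFD (M : Bimodule.{u, v, w} P k) : Prop :=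
  ∀ t : Point P, FiniteDimensional k (M.obj t)

/-- The map `φ = (h, v) : M_s → M_(t.x, s.y) ⊕ M_(s.x, t.y)`. -/
def phi (M : Bimodule.{u, v, w} P k) {s t : Point P} (h : s ≤ t) :
    M.obj s →ₗ[k] M.obj ⟨t.x, s.y⟩ × M.obj ⟨s.x, t.y⟩ :=
  (M.rho (s := s) (t := ⟨t.x, s.y⟩) ⟨h.1, le_rfl⟩).prod
    (M.rho (s := s) (t := ⟨s.x, t.y⟩) ⟨le_rfl, h.2⟩)

/-- The map `ψ = v - h : M_(t.x, s.y) ⊕ M_(s.x, t.y) → M_t`. -/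
def psi (M : Bimodule.{u, v, w} P k) {s t : Point P} (h : s ≤ t) :
    M.obj ⟨t.x, s.y⟩ × M.obj ⟨s.x, t.y⟩ →ₗ[k] M.obj t :=
  (M.rho (s := ⟨t.x, s.y⟩) (t := t) ⟨le_rfl, h.2⟩).coprod
    (-(M.rho (s := ⟨s.x, t.y⟩) (t := t) ⟨h.1, le_rfl⟩))

/-- Exactness: `Im φ = Ker ψ` for all `s ≤ t`. -/
def IsExact (M : Bimodule.{u, v, w} P k) : Prop :=
  ∀ (s t : Point P) (h : s ≤ t), LinearMap.range (M.phi h) = LinearMap.ker (M.psi h)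

/-- `M` is isomorphic to the direct sum of the family `N`: there are isomorphisms
`M_t ≅ ⨁ i, (N i)_t`, natural in `t`. -/
def IsoDirectSum (M : Bimodule.{u, v, w} P k) {I : Type} (N : I → Bimodule.{u, u, w} P k) : Prop :=
  ∃ e : ∀ t : Point P, M.obj t ≃ₗ[k] ⨁ i, (N i).obj t,
    ∀ (s t : Point P) (h : s ≤ t) (m : M.obj s) (i : I),
      e t (M.rho h m) i = (N i).rho h (e s m i)

end Basic

end Bimodule

/-- Decorated reals, with `-∞` and `+∞` added: `down x` and `up x` are the two decorations of the
real `x`, placed immediately below and immediately above `x`. -/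
inductive DecReal where
  | negInf : DecReal
  | down (x : ℝ) : DecReal
  | up (x : ℝ) : DecReal
  | posInf : DecReal

namespace DecReal

/-- The relation `d ≤ z` between a decorated real `d` and a real `z`. -/
def LeReal : DecReal → ℝ → Prop
  | negInf, _ => True
  | down x, z => x ≤ z
  | up x, z => x < z
  | posInf, _ => False

/-- The relation `z ≤ d` between a real `z` and a decorated real `d`. -/
def GeReal : DecReal → ℝ → Prop
  | negInf, _ => False
  | down x, z => z < x
  | up x, z => z ≤ x
  | posInf, _ => True

theorem LeReal.mono {d : DecReal} {z z' : ℝ} (h : d.LeReal z) (hz : z ≤ z') : d.LeReal z' := by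
  cases d
  · trivial
  · exact le_trans h hz
  · exact lt_of_lt_of_le h hz
  · exact h

theorem GeReal.anti {d : DecReal} {z z' : ℝ} (h : d.GeReal z') (hz : z ≤ z') : d.GeReal z := by
  cases d
  · exact h
  · exact lt_of_le_of_lt hz h
  · exact le_trans hz h
  · trivial

end DecReal

/-- Birth quadrant, death quadrant, horizontal band, vertical band. -/
inductive ShapeType where
  | birth
  | death
  | horizontal
  | vertical

/-- A shape: a shape type and two decorated reals. -/
structure Shape where
  type : ShapeType
  x : DecReal
  y : DecReal

namespace Shape

/-- The support of a shape, a subset of the plane. -/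
def supp : Shape → Set (Point ℝ)
  | ⟨.birth, x, y⟩ => {t | x.LeReal t.x ∧ y.LeReal t.y}
  | ⟨.death, x, y⟩ => {t | x.GeReal t.x ∧ y.GeReal t.y}
  | ⟨.horizontal, x, y⟩ => {t | x.LeReal t.y ∧ y.GeReal t.y}
  | ⟨.vertical, x, y⟩ => {t | x.LeReal t.x ∧ y.GeReal t.x}

theorem supp_convex (F : Shape) {r s t : Point ℝ} (hrs : r ≤ s) (hst : s ≤ t)
    (hr : r ∈ F.supp) (ht : t ∈ F.supp) : s ∈ F.supp := by
  obtain ⟨_ | _ | _ | _, x, y⟩ := F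
  · exact ⟨hr.1.mono hrs.1, hr.2.mono hrs.2⟩
  · exact ⟨ht.1.anti hst.1, ht.2.anti hst.2⟩
  · exact ⟨hr.1.mono hrs.2, ht.2.anti hst.2⟩
  · exact ⟨hr.1.mono hrs.1, ht.2.anti hst.1⟩

/-- The support of a shape restricted to `P × P`, where `P` is seen inside `ℝ` through `c`. -/
def suppOn {P : Type w} [PartialOrder P] (c : P →o ℝ) (F : Shape) : Set (Point P) :=
  {t | (⟨c t.x, c t.y⟩ : Point ℝ) ∈ F.supp}

theorem suppOn_convex {P : Type w} [PartialOrder P] (c : P →o ℝ) (F : Shape) {r s t : Point P}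
    (hrs : r ≤ s) (hst : s ≤ t) (hr : r ∈ F.suppOn c) (ht : t ∈ F.suppOn c) : s ∈ F.suppOn c :=
  F.supp_convex (r := ⟨c r.x, c r.y⟩) (s := ⟨c s.x, c s.y⟩) (t := ⟨c t.x, c t.y⟩)
    ⟨c.monotone hrs.1, c.monotone hrs.2⟩ ⟨c.monotone hst.1, c.monotone hst.2⟩ hr ht

end Shape

/-- The space at `t` of the block module supported on `S`: functions to `k` from a type that has
exactly one element if `t ∈ S` and none otherwise. It is a copy of `k` if `t ∈ S`, and zero
otherwise. -/
abbrev BlockSpace (k : Type u) {Q : Type w} (S : Set Q) (t : Q) : Type u :=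
  PLift (t ∈ S) → k

open Classical in
/-- The map from `s` to `t` of the block module supported on `S`: the identity of `k` if `s` and `t`
both lie in `S`, and zero otherwise. -/
noncomputable def blockMap (k : Type u) [Field k] {Q : Type w} (S : Set Q) (s t : Q) :
    BlockSpace k S s →ₗ[k] BlockSpace k S t where
  toFun f := fun _ => if hs : s ∈ S then f ⟨hs⟩ else 0
  map_add' f g := by
    funext ht
    by_cases hs : s ∈ S <;> simp [hs]
  map_smul' a f := by
    funext ht
    by_cases hs : s ∈ S <;> simp [hs]

theorem blockMap_self (k : Type u) [Field k] {Q : Type w} (S : Set Q) (t : Q) :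
    blockMap k S t t = LinearMap.id := by
  refine LinearMap.ext fun f => ?_
  funext ht
  simp [blockMap, ht.down]

theorem blockMap_comp (k : Type u) [Field k] {Q : Type w} (S : Set Q) {r s t : Q}
    (h : r ∈ S → t ∈ S → s ∈ S) :
    (blockMap k S s t).comp (blockMap k S r s) = blockMap k S r t := by
  refine LinearMap.ext fun f => ?_
  funext ht
  by_cases hr : r ∈ S
  · simp [blockMap, hr, h hr ht.down]
  · simp [blockMap, hr]

/-- The block module of the shape `F`, indexed over `P × P` (seen inside the plane through `c`). -/
noncomputable def blockModule (k : Type u) [Field k] {P : Type w} [PartialOrder P] (c : P →o ℝ)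
    (F : Shape) : Bimodule.{u, u, w} P k where
  obj t := ModuleCat.of k (BlockSpace k (F.suppOn c) t)
  map {s t} _ := ModuleCat.ofHom (blockMap k (F.suppOn c) s t)
  map_id t := by
    rw [blockMap_self]
    rfl
  map_comp {r s t} p q := by
    rw [← ModuleCat.ofHom_comp,
      blockMap_comp k _ fun hr ht => F.suppOn_convex c (leOfHom p) (leOfHom q) hr ht]

/-- `M` is isomorphic to the direct sum of a family (that is, a multiset) of block modules indexed
over `P × P`. -/
def Bimodule.IsBlockDecomposable {k : Type u} [Field k] {P : Type w} [PartialOrder P] (c : P →o ℝ)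
    (M : Bimodule.{u, v, w} P k) : Prop :=
  ∃ (I : Type) (F : I → Shape), M.IsoDirectSum fun i => blockModule k c (F i)

/-- The integers inside the reals. -/
def intToReal : ℤ →o ℝ := ⟨fun n => (n : ℝ), Int.cast_mono⟩

/-- The natural numbers inside the reals. -/
def natToReal : ℕ →o ℝ := ⟨fun n => (n : ℝ), Nat.mono_cast⟩

/-!
The decomposition is built by splitting off one block at a time. A direct summand of `M` isomorphic
to a block module on `S` amounts to vectors `elt t` and functionals `func t`, for `t ∈ S`,
compatible with the structure maps and pairing to `1` (`Bimodule.SummandOn`). Compatible families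
are produced by duality from direct limits: a functional on the direct limit of a directed system is
a compatible family of functionals, and, by finite-dimensionality, a functional on the direct limit
of the dual spaces is a compatible family of vectors. Hence a summand on `S` exists as soon as one
vector, at one point of `S`, lifts to all earlier points of `S` by vectors that die outside `S`, and
never becomes a sum of images from outside `S` at later points (`Bimodule.exists_summandOn`).

For a nonzero exact `M` over `ℤ`, such a vector always exists (`Bimodule.exists_summandOn_block`). A
vector killed by both the step to the right and the step upwards gives a death quadrant. If there is
none, a vector killed by the step to the right gives a vertical band, whose left end is found by
intersecting the kernel with the images from further left; symmetrically for horizontal bands. If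
all maps are injective, intersecting the horizontal and the vertical images gives a birth quadrant,
possibly unbounded to the left or below. Exactness enters only as the lifting property
`Bimodule.IsExact.exists_lift`; finite-dimensionality makes the chains of images stabilize.

By Zorn's lemma there is a maximal set of block summands that are pairwise orthogonal, each one's
functionals vanishing on the vectors of the others. At each point only finitely many of them are
nonzero, so they split off, and their complement is the common kernel of their functionals. It is
exact as a direct summand of `M`; were it nonzero, it would have a block summand, contradicting
maximality. So it is zero, and `M` is the direct sum of the family.

A bimodule over `ℕ` is handled through its pullback along the retraction `Int.toNat : ℤ → ℕ`, which
is again exact.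
-/

/-! ### Compatible functionals and compatible vectors in directed systems -/

/-- If `x` survives in a directed system of vector spaces, some functional on the direct limit takes
the value `1` at it. -/
theorem exists_compatible_dual {k : Type*} [Field k] {ι : Type*} [Preorder ι] [IsDirectedOrder ι]
    (G : ι → Type*) [∀ i, AddCommGroup (G i)] [∀ i, Module k (G i)]
    (f : ∀ i j, i ≤ j → G i →ₗ[k] G j) (hself : ∀ i x, f i i le_rfl x = x)
    (hmap : ∀ i j l (hij : i ≤ j) (hjl : j ≤ l) x,
      f j l hjl (f i j hij x) = f i l (hij.trans hjl) x)
    (p : ι) (x : G p) (hx : ∀ j (h : p ≤ j), f p j h x ≠ 0) :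
    ∃ φ : ∀ i, Module.Dual k (G i),
      (∀ i j (h : i ≤ j) y, φ j (f i j h y) = φ i y) ∧ φ p x = 1 := by
  classical
  have : DirectedSystem G (f · · ·) := ⟨hself, fun _ _ _ hij hjl x =>
    hmap _ _ _ hij hjl x⟩
  have hne : Module.DirectLimit.of k ι G f p x ≠ 0 := by
    intro h0
    obtain ⟨j, hj, hj0⟩ := Module.DirectLimit.of.zero_exact h0
    exact hx j hj hj0
  obtain ⟨θ, hθ⟩ := Module.Projective.exists_dual_eq_one k hne
  exact ⟨fun i => θ ∘ₗ Module.DirectLimit.of k ι G f i,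
    fun i j h y => by simp [Module.DirectLimit.of_f], hθ⟩

/-- The dual statement for inverse systems of finite-dimensional spaces: a functional `θ` at `p`
that is nonzero on the image of every earlier space takes the value `1` at the `p`-component of some
compatible family. Such a family is a functional on the direct limit of the dual spaces. -/
theorem exists_compatible_vector {k : Type*} [Field k] {ι : Type*} [Preorder ι]
    [IsCodirectedOrder ι] (E : ι → Type*) [∀ i, AddCommGroup (E i)] [∀ i, Module k (E i)]
    [∀ i, FiniteDimensional k (E i)]
    (g : ∀ i j, i ≤ j → E i →ₗ[k] E j) (hself : ∀ i x, g i i le_rfl x = x)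
    (hmap : ∀ i j l (hij : i ≤ j) (hjl : j ≤ l) x,
      g j l hjl (g i j hij x) = g i l (hij.trans hjl) x)
    (p : ι) (θ : Module.Dual k (E p)) (hθ : ∀ i (h : i ≤ p), ∃ x, θ (g i p h x) ≠ 0) :
    ∃ e : ∀ i, E i, (∀ i j (h : i ≤ j), g i j h (e i) = e j) ∧ θ (e p) = 1 := by
  obtain ⟨φ, hφ, hφp⟩ := exists_compatible_dual (k := k) (ι := ιᵒᵈ)
    (fun i => Module.Dual k (E (OrderDual.ofDual i)))
    (fun i j h => (g (OrderDual.ofDual j) (OrderDual.ofDual i) h).dualMap)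
    (fun i x => by ext y; simp [hself])
    (fun i j l hij hjl x => by
      ext y
      exact congrArg x (hmap (OrderDual.ofDual l) (OrderDual.ofDual j) (OrderDual.ofDual i) hjl hij y))
    (OrderDual.toDual p) θ
    (fun j h h0 => by
      obtain ⟨x, hx⟩ := hθ (OrderDual.ofDual j) h
      exact hx (LinearMap.congr_fun h0 x))
  have hreflexive : ∀ i, ∃ e : E i, ∀ ξ : Module.Dual k (E i), ξ e = φ (OrderDual.toDual i) ξ :=
    fun i => ⟨(Module.evalEquiv k (E i)).symm (φ (OrderDual.toDual i)),
      fun ξ => Module.apply_evalEquiv_symm_apply k (E i) ξ (φ (OrderDual.toDual i))⟩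
  choose e he using hreflexive
  refine ⟨e, fun i j h => ?_, (he p θ).trans hφp⟩
  rw [← sub_eq_zero, ← Module.forall_dual_apply_eq_zero_iff k]
  intro ξ
  rw [map_sub, sub_eq_zero, he j ξ]
  exact (he i ((g i j h).dualMap ξ)).trans (hφ (OrderDual.toDual j) (OrderDual.toDual i) h ξ)

/-- A chain of subspaces of a finite-dimensional space has a least member. -/
theorem exists_submodule_le_of_chain {k V : Type*} [Field k] [AddCommGroup V] [Module k V]
    [FiniteDimensional k V] {ι : Type*} [Nonempty ι] (W : ι → Submodule k V)
    (hW : ∀ i j, W i ≤ W j ∨ W j ≤ W i) : ∃ i, ∀ j, W i ≤ W j := by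
  obtain ⟨_, ⟨i, rfl⟩, hi⟩ := wellFounded_lt.has_min (Set.range W) (Set.range_nonempty W)
  refine ⟨i, fun j => (hW i j).elim id fun h => ?_⟩
  exact (eq_of_le_of_not_lt h (hi _ ⟨j, rfl⟩)).ge

namespace Bimodule

/-! ### Block summands -/

section Summands

variable {P : Type w} [PartialOrder P] {k : Type u} [Field k]

theorem rho_self (M : Bimodule.{u, v, w} P k) {t : Point P} (h : t ≤ t) (m : M.obj t) :
    M.rho h m = m := by
  exact LinearMap.congr_fun (congrArg ModuleCat.Hom.hom (M.map_id t)) m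

theorem rho_rho (M : Bimodule.{u, v, w} P k) {r s t : Point P} (h₁ : r ≤ s) (h₂ : s ≤ t)
    (m : M.obj r) : M.rho h₂ (M.rho h₁ m) = M.rho (h₁.trans h₂) m := by
  exact (LinearMap.congr_fun (congrArg ModuleCat.Hom.hom
    (M.map_comp (homOfLE h₁) (homOfLE h₂))) m).symm

theorem rho_eq_zero_of_le (M : Bimodule.{u, v, w} P k) {r s t : Point P} (h₁ : r ≤ s) (h₂ : s ≤ t)
    {m : M.obj r} (hm : M.rho h₁ m = 0) : M.rho (h₁.trans h₂) m = 0 := by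
  rw [← M.rho_rho h₁ h₂, hm, map_zero]

/-- A direct summand of `M` isomorphic to the block module supported on `S`: the vectors `elt t` are
the images of `1` under an inclusion of the block module into `M`, the functionals `func t` are the
components of a retraction. Both are zero off `S`, so that the naturality conditions `rho_elt` and
`func_rho` also say that `elt` dies outside `S` and that `func` kills what comes from outside `S`.
-/
structure SummandOn (M : Bimodule.{u, v, w} P k) (S : Set (Point P)) where
  elt : ∀ t, M.obj t
  func : ∀ t, M.obj t →ₗ[k] k
  elt_off : ∀ t, t ∉ S → elt t = 0
  func_off : ∀ t, t ∉ S → func t = 0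
  rho_elt : ∀ s t (h : s ≤ t), s ∈ S → M.rho h (elt s) = elt t
  func_rho : ∀ s t (h : s ≤ t), t ∈ S → ∀ m, func t (M.rho h m) = func s m
  func_elt : ∀ t, t ∈ S → func t (elt t) = 1

/-- The subspace of `M_t` spanned by the images of the spaces `M_s` with `s` outside `S`. -/
def imageOutside (M : Bimodule.{u, v, w} P k) (S : Set (Point P)) (t : Point P) :
    Submodule k (M.obj t) :=
  ⨆ (s : Point P) (h : s ≤ t) (_ : s ∉ S), LinearMap.range (M.rho h)

/-- The vectors of `M_s` that map to zero at every point outside `S`. -/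
def kernelOutside (M : Bimodule.{u, v, w} P k) (S : Set (Point P)) (s : Point P) :
    Submodule k (M.obj s) :=
  ⨅ (t : Point P) (h : s ≤ t) (_ : t ∉ S), LinearMap.ker (M.rho h)

theorem mem_kernelOutside {M : Bimodule.{u, v, w} P k} {S : Set (Point P)} {s : Point P}
    {m : M.obj s} : m ∈ M.kernelOutside S s ↔ ∀ t (h : s ≤ t), t ∉ S → M.rho h m = 0 := by
  simp [kernelOutside, Submodule.mem_iInf]

theorem rho_mem_imageOutside (M : Bimodule.{u, v, w} P k) {S : Set (Point P)} {s t : Point P}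
    (h : s ≤ t) (hs : s ∉ S) (m : M.obj s) : M.rho h m ∈ M.imageOutside S t :=
  Submodule.mem_iSup_of_mem s <| Submodule.mem_iSup_of_mem h <| Submodule.mem_iSup_of_mem hs ⟨m, rfl⟩

theorem imageOutside_le_comap (M : Bimodule.{u, v, w} P k) (S : Set (Point P)) {s t : Point P}
    (h : s ≤ t) : M.imageOutside S s ≤ (M.imageOutside S t).comap (M.rho h) := by
  refine iSup_le fun r => iSup_le fun hr => iSup_le fun hrS => ?_
  rintro _ ⟨m, rfl⟩
  rw [Submodule.mem_comap, rho_rho]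
  exact M.rho_mem_imageOutside _ hrS m

theorem rho_mem_kernelOutside (M : Bimodule.{u, v, w} P k) (S : Set (Point P)) {s t : Point P}
    (h : s ≤ t) {m : M.obj s} (hm : m ∈ M.kernelOutside S s) : M.rho h m ∈ M.kernelOutside S t := by
  rw [mem_kernelOutside] at hm ⊢
  intro r hr hrS
  rw [rho_rho]
  exact hm r _ hrS

/-- A vector `m` at a point `p` of `S` yields a block summand on `S` as soon as it lifts to every
earlier point of `S`, by a vector that dies outside `S`, and stays, at every later point of `S`,
outside the span of the images from outside `S`. -/
theorem exists_summandOn (M : Bimodule.{u, v, w} P k) (hM : M.IsPFD) {S : Set (Point P)}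
    (hup : DirectedOn (· ≤ ·) S) (hdown : DirectedOn (· ≥ ·) S) {p : Point P} (hp : p ∈ S)
    (m : M.obj p)
    (hlift : ∀ s (h : s ≤ p), s ∈ S → ∃ e ∈ M.kernelOutside S s, M.rho h e = m)
    (havoid : ∀ t (h : p ≤ t), t ∈ S → M.rho h m ∉ M.imageOutside S t) :
    Nonempty (M.SummandOn S) := by
  classical
  have : ∀ t, FiniteDimensional k (M.obj t) := hM
  have : IsDirectedOrder S := ⟨fun a b => by
    obtain ⟨c, hc, h1, h2⟩ := hup a a.2 b b.2
    exact ⟨⟨c, hc⟩, h1, h2⟩⟩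
  have : IsCodirectedOrder S := ⟨fun a b => by
    obtain ⟨c, hc, h1, h2⟩ := hdown a a.2 b b.2
    exact ⟨⟨c, hc⟩, h1, h2⟩⟩
  obtain ⟨φ, hφ, hφp⟩ := exists_compatible_dual (k := k) (ι := S)
    (fun t => M.obj t ⧸ M.imageOutside S t)
    (fun s t h => (M.imageOutside S s).mapQ _ (M.rho h) (M.imageOutside_le_comap S h))
    (fun t x => by
      obtain ⟨x, rfl⟩ := Submodule.mkQ_surjective _ x
      simp [rho_self])
    (fun r s t h1 h2 x => by
      obtain ⟨x, rfl⟩ := Submodule.mkQ_surjective _ x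
      simp [rho_rho])
    ⟨p, hp⟩ (Submodule.Quotient.mk m)
    (fun t h => by
      simp only [Submodule.mapQ_apply, ne_eq, Submodule.Quotient.mk_eq_zero]
      exact havoid t h t.2)
  obtain ⟨e, he, hep⟩ := exists_compatible_vector (k := k) (ι := S)
    (fun s => M.kernelOutside S s)
    (fun s t h => (M.rho h).restrict fun _ hx => M.rho_mem_kernelOutside S h hx)
    (fun s x => Subtype.ext (M.rho_self _ _))
    (fun r s t h1 h2 x => Subtype.ext (M.rho_rho _ _ _))
    ⟨p, hp⟩ (φ ⟨p, hp⟩ ∘ₗ Submodule.mkQ _ ∘ₗ Submodule.subtype _)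
    (fun s h => by
      obtain ⟨x, hx, hxm⟩ := hlift s h s.2
      refine ⟨⟨x, hx⟩, ?_⟩
      have hval : φ ⟨p, hp⟩ (Submodule.Quotient.mk (M.rho h x)) = 1 := by rw [hxm, hφp]
      exact hval.trans_ne one_ne_zero)
  let f : ∀ t, M.obj t →ₗ[k] k := fun t =>
    if h : t ∈ S then φ ⟨t, h⟩ ∘ₗ Submodule.mkQ _ else 0
  let x : ∀ t, M.obj t := fun t => if h : t ∈ S then (e ⟨t, h⟩ : M.obj t) else 0
  have hf : ∀ t (h : t ∈ S), f t = φ ⟨t, h⟩ ∘ₗ Submodule.mkQ _ := fun t h => dif_pos h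
  have hx : ∀ t (h : t ∈ S), x t = e ⟨t, h⟩ := fun t h => dif_pos h
  have rho_x : ∀ s t (h : s ≤ t), s ∈ S → M.rho h (x s) = x t := by
    intro s t h hs
    rw [hx s hs]
    by_cases ht : t ∈ S
    · rw [hx t ht, ← he ⟨s, hs⟩ ⟨t, ht⟩ h]
      rfl
    · rw [show x t = 0 from dif_neg ht]
      exact mem_kernelOutside.1 (e ⟨s, hs⟩).2 t h ht
  have f_rho : ∀ s t (h : s ≤ t), t ∈ S → ∀ m, f t (M.rho h m) = f s m := by
    intro s t h ht m
    rw [hf t ht]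
    by_cases hs : s ∈ S
    · rw [hf s hs]
      exact hφ ⟨s, hs⟩ ⟨t, ht⟩ h (Submodule.Quotient.mk m)
    · rw [show f s = 0 from dif_neg hs]
      have h0 : (M.imageOutside S t).mkQ (M.rho h m) = 0 :=
        (Submodule.Quotient.mk_eq_zero _).2 (M.rho_mem_imageOutside h hs m)
      rw [LinearMap.comp_apply, h0, map_zero, LinearMap.zero_apply]
  refine ⟨⟨x, f, fun t ht => dif_neg ht, fun t ht => dif_neg ht, rho_x, f_rho, fun t ht => ?_⟩⟩
  have hpx : f p (x p) = 1 := by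
    rw [hx p hp, hf p hp]
    exact hep
  -- The pairing is the same at any two points of `S` with a common upper bound in `S`.
  obtain ⟨q, hq, htq, hpq⟩ := hup t ht p hp
  rw [← f_rho t q htq hq, rho_x t q htq ht, ← rho_x p q hpq hp, f_rho p q hpq hq, hpx]

end Summands

end Bimodule

/-! ### Upper sets of integers and decorated reals -/

theorem DecReal.exists_leReal_iff {X : Set ℤ} (hX : IsUpperSet X) :
    ∃ d : DecReal, ∀ z : ℤ, d.LeReal z ↔ z ∈ X := by
  by_cases hne : X.Nonempty
  · by_cases hb : ∃ b, ∀ z ∈ X, b ≤ z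
    · obtain ⟨a, ha, hle⟩ := Int.exists_least_of_bdd hb hne
      exact ⟨.down a, fun z => ⟨fun h => hX (Int.cast_le.1 h) ha, fun h => Int.cast_le.2 (hle z h)⟩⟩
    · push Not at hb
      refine ⟨.negInf, fun z => ⟨fun _ => ?_, fun _ => trivial⟩⟩
      obtain ⟨a, ha, hlt⟩ := hb z
      exact hX hlt.le ha
  · exact ⟨.posInf, fun z => ⟨False.elim, fun h => hne ⟨z, h⟩⟩⟩

theorem Submodule.eq_zero_or_exists_mem_of_mem_iSup_of_chain {R V ι : Type*} [Semiring R]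
    [AddCommMonoid V] [Module R V] {W : ι → Submodule R V}
    (hW : ∀ i j, W i ≤ W j ∨ W j ≤ W i) {z : V} (hz : z ∈ ⨆ i, W i) : z = 0 ∨ ∃ i, z ∈ W i := by
  rcases isEmpty_or_nonempty ι with hι | hι
  · rw [iSup_of_empty, Submodule.mem_bot] at hz
    exact Or.inl hz
  · refine Or.inr ((Submodule.mem_iSup_of_directed W fun i j => ?_).1 hz)
    exact (hW i j).elim (fun h => ⟨j, h, le_rfl⟩) fun h => ⟨i, le_rfl, h⟩

section Products

variable {P : Type w} [LinearOrder P]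

/-- The product of `X` and `Y`, as a set of points. -/
def prodSet (X Y : Set P) : Set (Point P) := {t | t.x ∈ X ∧ t.y ∈ Y}

theorem directedOn_prodSet (X Y : Set P) : DirectedOn (· ≤ ·) (prodSet X Y) := fun s hs t ht =>
  ⟨⟨max s.x t.x, max s.y t.y⟩,
    ⟨max_rec' (· ∈ X) hs.1 ht.1,
      max_rec' (· ∈ Y) hs.2 ht.2⟩,
    ⟨le_max_left _ _, le_max_left _ _⟩, ⟨le_max_right _ _, le_max_right _ _⟩⟩

theorem codirectedOn_prodSet (X Y : Set P) : DirectedOn (· ≥ ·) (prodSet X Y) := fun s hs t ht =>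
  ⟨⟨min s.x t.x, min s.y t.y⟩,
    ⟨min_rec' (· ∈ X) hs.1 ht.1,
      min_rec' (· ∈ Y) hs.2 ht.2⟩,
    ⟨min_le_left _ _, min_le_left _ _⟩, ⟨min_le_right _ _, min_le_right _ _⟩⟩

end Products

namespace Bimodule

/-! ### Exact squares -/

section Exact

variable {P : Type w} [PartialOrder P] {k : Type u} [Field k]

/-- Over an exact square, two vectors with the same image come from a common vector. -/
theorem IsExact.exists_lift {M : Bimodule.{u, v, w} P k} (hM : M.IsExact) {x x' y y' : P}
    (hx : x ≤ x') (hy : y ≤ y') (b : M.obj ⟨x', y⟩) (c : M.obj ⟨x, y'⟩)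
    (h : M.rho (s := ⟨x', y⟩) (t := ⟨x', y'⟩) ⟨le_rfl, hy⟩ b =
      M.rho (s := ⟨x, y'⟩) (t := ⟨x', y'⟩) ⟨hx, le_rfl⟩ c) :
    ∃ a : M.obj ⟨x, y⟩, M.rho (s := ⟨x, y⟩) (t := ⟨x', y⟩) ⟨hx, le_rfl⟩ a = b ∧
      M.rho (s := ⟨x, y⟩) (t := ⟨x, y'⟩) ⟨le_rfl, hy⟩ a = c := by
  have hmem : (b, c) ∈ LinearMap.ker (M.psi (s := ⟨x, y⟩) (t := ⟨x', y'⟩) ⟨hx, hy⟩) := by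
    rw [LinearMap.mem_ker]
    refine Eq.trans ?_ (sub_eq_zero.2 h)
    simp [psi, sub_eq_add_neg]
  rw [← hM] at hmem
  obtain ⟨a, ha⟩ := hmem
  exact ⟨a, congrArg Prod.fst ha, congrArg Prod.snd ha⟩

theorem isExact_of_exists_lift {M : Bimodule.{u, v, w} P k}
    (hM : ∀ {x x' y y' : P} (hx : x ≤ x') (hy : y ≤ y') (b : M.obj ⟨x', y⟩) (c : M.obj ⟨x, y'⟩),
      M.rho (s := ⟨x', y⟩) (t := ⟨x', y'⟩) ⟨le_rfl, hy⟩ b =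
        M.rho (s := ⟨x, y'⟩) (t := ⟨x', y'⟩) ⟨hx, le_rfl⟩ c →
      ∃ a : M.obj ⟨x, y⟩, M.rho (s := ⟨x, y⟩) (t := ⟨x', y⟩) ⟨hx, le_rfl⟩ a = b ∧
        M.rho (s := ⟨x, y⟩) (t := ⟨x, y'⟩) ⟨le_rfl, hy⟩ a = c) :
    M.IsExact := by
  rintro ⟨x, y⟩ ⟨x', y'⟩ h
  refine le_antisymm ?_ ?_
  · rintro _ ⟨a, rfl⟩
    simp [LinearMap.mem_ker, phi, psi, rho_rho]
  · rintro ⟨b, c⟩ hbc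
    rw [LinearMap.mem_ker] at hbc
    have hbc' : M.rho (s := ⟨x', y⟩) (t := ⟨x', y'⟩) ⟨le_rfl, h.2⟩ b =
        M.rho (s := ⟨x, y'⟩) (t := ⟨x', y'⟩) ⟨h.1, le_rfl⟩ c := by
      refine sub_eq_zero.1 (Eq.trans ?_ hbc)
      simp [psi, sub_eq_add_neg]
    obtain ⟨a, rfl, rfl⟩ := hM h.1 h.2 b c hbc'
    exact ⟨a, rfl⟩

/-- The bimodule obtained from `M` by precomposition with a monotone map of index sets. -/
def pullback {Q : Type w} [PartialOrder Q] (M : Bimodule.{u, v, w} Q k) (f : Point P → Point Q)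
    (hf : Monotone f) : Bimodule.{u, v, w} P k :=
  hf.functor ⋙ M

theorem monotone_swap : Monotone fun t : Point P => (⟨t.y, t.x⟩ : Point P) := fun _ _ h => ⟨h.2, h.1⟩

/-- The bimodule `M` with the two coordinates exchanged. -/
abbrev swap (M : Bimodule.{u, v, w} P k) : Bimodule.{u, v, w} P k :=
  M.pullback _ monotone_swap

theorem IsExact.swap {M : Bimodule.{u, v, w} P k} (hM : M.IsExact) : M.swap.IsExact :=
  isExact_of_exists_lift fun hx hy b c h => by
    obtain ⟨a, ha, ha'⟩ := hM.exists_lift hy hx c b h.symm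
    exact ⟨a, ha', ha⟩

/-- The summand of `M` corresponding to a summand of `M` with the coordinates exchanged. -/
def SummandOn.ofSwap {M : Bimodule.{u, v, w} P k} {S : Set (Point P)} (σ : M.swap.SummandOn S) :
    M.SummandOn {t | ⟨t.y, t.x⟩ ∈ S} where
  elt t := σ.elt (⟨t.y, t.x⟩ : Point P)
  func t := σ.func (⟨t.y, t.x⟩ : Point P)
  elt_off _ ht := σ.elt_off _ ht
  func_off _ ht := σ.func_off _ ht
  rho_elt s t h hs := σ.rho_elt ⟨s.y, s.x⟩ ⟨t.y, t.x⟩ ⟨h.2, h.1⟩ hs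
  func_rho s t h ht := σ.func_rho ⟨s.y, s.x⟩ ⟨t.y, t.x⟩ ⟨h.2, h.1⟩ ht
  func_elt _ ht := σ.func_elt _ ht

end Exact

/-- The span of the images from outside a product set consists of the sums of a vector coming from
outside in the horizontal direction and of one coming from outside in the vertical direction. -/
theorem exists_add_of_mem_imageOutside {P : Type w} [LinearOrder P] {k : Type u} [Field k]
    {M : Bimodule.{u, v, w} P k} {X Y : Set P} {x y : P} {z : M.obj ⟨x, y⟩}
    (hz : z ∈ M.imageOutside (prodSet X Y) ⟨x, y⟩) :
    ∃ u v, u + v = z ∧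
      (u = 0 ∨ ∃ (a : P) (h : a ≤ x) (u₀ : M.obj ⟨a, y⟩), a ∉ X ∧
        M.rho (s := ⟨a, y⟩) (t := ⟨x, y⟩) ⟨h, le_rfl⟩ u₀ = u) ∧
      (v = 0 ∨ ∃ (b : P) (h : b ≤ y) (v₀ : M.obj ⟨x, b⟩), b ∉ Y ∧
        M.rho (s := ⟨x, b⟩) (t := ⟨x, y⟩) ⟨le_rfl, h⟩ v₀ = v) := by
  let U : {a : P // a ≤ x ∧ a ∉ X} → Submodule k (M.obj ⟨x, y⟩) := fun a =>
    LinearMap.range (M.rho (s := ⟨a, y⟩) (t := ⟨x, y⟩) ⟨a.2.1, le_rfl⟩)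
  let V : {b : P // b ≤ y ∧ b ∉ Y} → Submodule k (M.obj ⟨x, y⟩) := fun b =>
    LinearMap.range (M.rho (s := ⟨x, b⟩) (t := ⟨x, y⟩) ⟨le_rfl, b.2.1⟩)
  have hU : ∀ a a', a ≤ a' → U a ≤ U a' := by
    rintro a a' h _ ⟨m, rfl⟩
    exact ⟨M.rho (s := ⟨a, y⟩) (t := ⟨a', y⟩) ⟨h, le_rfl⟩ m, M.rho_rho _ _ _⟩
  have hV : ∀ b b', b ≤ b' → V b ≤ V b' := by
    rintro b b' h _ ⟨m, rfl⟩
    exact ⟨M.rho (s := ⟨x, b⟩) (t := ⟨x, b'⟩) ⟨le_rfl, h⟩ m, M.rho_rho _ _ _⟩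
  have hle : M.imageOutside (prodSet X Y) ⟨x, y⟩ ≤ (⨆ a, U a) ⊔ ⨆ b, V b := by
    refine iSup_le fun s => iSup_le fun h => iSup_le fun hs => ?_
    rintro _ ⟨m, rfl⟩
    by_cases hX : s.x ∈ X
    · refine Submodule.mem_sup_right (Submodule.mem_iSup_of_mem ⟨s.y, h.2, fun hY => hs ⟨hX, hY⟩⟩ ?_)
      exact ⟨M.rho (s := s) (t := ⟨x, s.y⟩) ⟨h.1, le_rfl⟩ m, M.rho_rho _ _ _⟩
    · refine Submodule.mem_sup_left (Submodule.mem_iSup_of_mem ⟨s.x, h.1, hX⟩ ?_)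
      exact ⟨M.rho (s := s) (t := ⟨s.x, y⟩) ⟨le_rfl, h.2⟩ m, M.rho_rho _ _ _⟩
  obtain ⟨u, hu, v, hv, rfl⟩ := Submodule.mem_sup.1 (hle hz)
  refine ⟨u, v, rfl, ?_, ?_⟩
  · refine (Submodule.eq_zero_or_exists_mem_of_mem_iSup_of_chain (fun a a' =>
      (le_total a a').imp (hU _ _) (hU _ _)) hu).imp id ?_
    rintro ⟨a, u₀, h⟩
    exact ⟨a, a.2.1, u₀, a.2.2, h⟩
  · refine (Submodule.eq_zero_or_exists_mem_of_mem_iSup_of_chain (fun b b' =>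
      (le_total b b').imp (hV _ _) (hV _ _)) hv).imp id ?_
    rintro ⟨b, v₀, h⟩
    exact ⟨b, b.2.1, v₀, b.2.2, h⟩

/-! ### A nonzero exact bimodule over the integers has a block summand -/

section Integers

variable {k : Type u} [Field k] {M : Bimodule.{u, v, 0} ℤ k}

/-- A nonzero vector that dies both one step to the right and one step upwards yields a death
quadrant: by exactness it lifts to all earlier points with the same property. -/
theorem exists_summandOn_death (hpfd : M.IsPFD) (hM : M.IsExact) {x y : ℤ} {m : M.obj ⟨x, y⟩}
    (hm : m ≠ 0)
    (hr : M.rho (s := ⟨x, y⟩) (t := ⟨x + 1, y⟩) ⟨(lt_add_one x).le, le_rfl⟩ m = 0)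
    (hu : M.rho (s := ⟨x, y⟩) (t := ⟨x, y + 1⟩) ⟨le_rfl, (lt_add_one y).le⟩ m = 0) :
    Nonempty (M.SummandOn (prodSet (Set.Iic x) (Set.Iic y))) := by
  refine M.exists_summandOn hpfd (directedOn_prodSet _ _) (codirectedOn_prodSet _ _)
    (p := ⟨x, y⟩) ⟨le_refl x, le_refl y⟩ m ?_ ?_
  · rintro ⟨a, b⟩ ⟨ha : a ≤ x, hb : b ≤ y⟩ -
    obtain ⟨e₁, he₁, he₁u⟩ := hM.exists_lift ha (lt_add_one y).le m 0 (by rw [map_zero, hu])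
    obtain ⟨e, her, he⟩ := hM.exists_lift (ha.trans (lt_add_one x).le) hb 0 e₁ (by
      rw [map_zero, ← hr, ← he₁, rho_rho])
    refine ⟨e, mem_kernelOutside.2 ?_, ?_⟩
    · rintro ⟨a', b'⟩ ⟨ha' : a ≤ a', hb' : b ≤ b'⟩ hS
      rcases lt_or_ge x a' with h | h
      · exact M.rho_eq_zero_of_le (r := ⟨a, b⟩) (s := ⟨x + 1, b⟩) (t := ⟨a', b'⟩)
          ⟨ha.trans (lt_add_one x).le, le_rfl⟩ ⟨h, hb'⟩ her
      · have h' : y < b' := lt_of_not_ge fun h' => hS ⟨h, h'⟩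
        refine M.rho_eq_zero_of_le (r := ⟨a, b⟩) (s := ⟨a, y + 1⟩) (t := ⟨a', b'⟩)
          ⟨le_rfl, hb.trans (lt_add_one y).le⟩ ⟨ha', h'⟩ ?_
        rw [← M.rho_rho (r := ⟨a, b⟩) (s := ⟨a, y⟩) (t := ⟨a, y + 1⟩) ⟨le_rfl, hb⟩
          ⟨le_rfl, (lt_add_one y).le⟩, he, he₁u]
    · rw [← he₁, ← he, rho_rho]
  · rintro ⟨x', y'⟩ ⟨hx : x ≤ x', hy : y ≤ y'⟩ ⟨hx' : x' ≤ x, hy' : y' ≤ y⟩ hmem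
    obtain rfl := le_antisymm hx hx'
    obtain rfl := le_antisymm hy hy'
    obtain ⟨u, v, huv, hu, hv⟩ := exists_add_of_mem_imageOutside hmem
    rw [rho_self] at huv
    have hu0 : u = 0 := hu.elim id fun ⟨a, h, _, ha, _⟩ => (ha h).elim
    have hv0 : v = 0 := hv.elim id fun ⟨b, h, _, hb, _⟩ => (hb h).elim
    exact hm (by rw [← huv, hu0, hv0, add_zero])

/-- If there are no vectors as in `exists_summandOn_death`, a nonzero vector that dies one step to
the right yields a vertical band. The left end of the band is read off from the decreasing chain of
the images, in the one-step kernel, of the spaces further left. -/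
theorem exists_summandOn_vertical (hpfd : M.IsPFD) (hM : M.IsExact)
    (hdeath : ∀ (x y : ℤ) (m : M.obj ⟨x, y⟩),
      M.rho (s := ⟨x, y⟩) (t := ⟨x + 1, y⟩) ⟨(lt_add_one x).le, le_rfl⟩ m = 0 →
      M.rho (s := ⟨x, y⟩) (t := ⟨x, y + 1⟩) ⟨le_rfl, (lt_add_one y).le⟩ m = 0 → m = 0)
    {x y : ℤ} {m₀ : M.obj ⟨x, y⟩} (hm₀ : m₀ ≠ 0)
    (hr : M.rho (s := ⟨x, y⟩) (t := ⟨x + 1, y⟩) ⟨(lt_add_one x).le, le_rfl⟩ m₀ = 0) :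
    ∃ X : Set ℤ, IsUpperSet X ∧ x ∈ X ∧ Nonempty (M.SummandOn (prodSet (X ∩ Set.Iic x) Set.univ)) := by
  have hfin : FiniteDimensional k (M.obj ⟨x, y⟩) := hpfd _
  have hx1 : x ≤ x + 1 := (lt_add_one x).le
  -- `A a`: some vector above `a` survives up to `x` and dies at `x + 1`.
  let A : ℤ → Prop := fun a => ∃ (h : a ≤ x) (w : M.obj ⟨a, y⟩),
    M.rho (s := ⟨a, y⟩) (t := ⟨x, y⟩) ⟨h, le_rfl⟩ w ≠ 0 ∧
      M.rho (s := ⟨a, y⟩) (t := ⟨x + 1, y⟩) ⟨h.trans hx1, le_rfl⟩ w = 0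
  let W : {a // A a} → Submodule k (M.obj ⟨x, y⟩) := fun a =>
    (LinearMap.ker (M.rho (s := ⟨a, y⟩) (t := ⟨x + 1, y⟩) ⟨a.2.1.trans hx1, le_rfl⟩)).map
      (M.rho (s := ⟨a, y⟩) (t := ⟨x, y⟩) ⟨a.2.1, le_rfl⟩)
  have hW : ∀ a a', a ≤ a' → W a ≤ W a' := by
    rintro a a' h _ ⟨m, hm, rfl⟩
    refine ⟨M.rho (s := ⟨a, y⟩) (t := ⟨a', y⟩) ⟨h, le_rfl⟩ m, ?_, M.rho_rho _ _ _⟩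
    have hm : M.rho (s := ⟨a, y⟩) (t := ⟨x + 1, y⟩) _ m = 0 := hm
    exact (M.rho_rho _ _ _).trans hm
  have hAx : A x := ⟨le_rfl, m₀, by rwa [rho_self], hr⟩
  have : Nonempty {a // A a} := ⟨⟨x, hAx⟩⟩
  obtain ⟨a₀, ha₀⟩ := exists_submodule_le_of_chain W fun a a' =>
    (le_total a a').imp (hW _ _) (hW _ _)
  obtain ⟨w₀, hw₀, hw₀r⟩ := a₀.2.2
  set m := M.rho (s := ⟨a₀, y⟩) (t := ⟨x, y⟩) ⟨a₀.2.1, le_rfl⟩ w₀ with hmdef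
  have hmr : M.rho (s := ⟨x, y⟩) (t := ⟨x + 1, y⟩) ⟨hx1, le_rfl⟩ m = 0 := by
    rw [hmdef, rho_rho, hw₀r]
  have hmW : ∀ a, m ∈ W a := fun a => ha₀ a ⟨w₀, hw₀r, rfl⟩
  -- A nonzero vector dying at `x + 1` survives all vertical maps: its last nonzero image would contradict
  -- `hdeath`.
  have hvert : ∀ (y' : ℤ) (n : ℕ) (z : ℤ) (h : z ≤ y'), y' ≤ z + n → ∀ m' : M.obj ⟨x, z⟩,
      M.rho (s := ⟨x, z⟩) (t := ⟨x + 1, z⟩) ⟨hx1, le_rfl⟩ m' = 0 →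
      M.rho (s := ⟨x, z⟩) (t := ⟨x, y'⟩) ⟨le_rfl, h⟩ m' = 0 → m' = 0 := by
    intro y' n
    induction n with
    | zero =>
      intro z h h' m' _ h0
      obtain rfl : z = y' := by lia
      rwa [rho_self] at h0
    | succ n ih =>
      intro z h h' m' h1 h0
      rcases h.eq_or_lt with rfl | hlt
      · rwa [rho_self] at h0
      · refine hdeath _ _ _ h1 (ih (z + 1) hlt (by push_cast at h'; lia) _ ?_ ?_)
        · rw [rho_rho]
          exact M.rho_eq_zero_of_le (r := ⟨x, z⟩) (s := ⟨x + 1, z⟩) (t := ⟨x + 1, z + 1⟩)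
            ⟨hx1, le_rfl⟩ ⟨le_rfl, (lt_add_one z).le⟩ h1
        · rw [rho_rho, h0]
  refine ⟨{a | a ≤ x → A a}, ?_, fun _ => hAx, ?_⟩
  · intro a b hab ha hb
    obtain ⟨h, w, hw, hw'⟩ := ha (hab.trans hb)
    refine ⟨hb, M.rho (s := ⟨a, y⟩) (t := ⟨b, y⟩) ⟨hab, le_rfl⟩ w, ?_, ?_⟩
    · rwa [rho_rho]
    · rwa [rho_rho]
  · refine M.exists_summandOn hpfd (directedOn_prodSet _ _) (codirectedOn_prodSet _ _)
      (p := ⟨x, y⟩) ⟨⟨fun _ => hAx, le_refl x⟩, trivial⟩ m ?_ ?_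
    · rintro ⟨a, c⟩ ⟨ha : a ≤ x, hc : c ≤ y⟩ ⟨⟨haA, -⟩, -⟩
      obtain ⟨w, hw, hwm⟩ := hmW ⟨a, haA ha⟩
      have hw : M.rho (s := ⟨a, y⟩) (t := ⟨x + 1, y⟩) _ w = 0 := hw
      obtain ⟨e, her, he⟩ := hM.exists_lift (ha.trans hx1) hc 0 w (by rw [map_zero, hw])
      refine ⟨e, mem_kernelOutside.2 ?_, ?_⟩
      · rintro ⟨a', c'⟩ ⟨ha' : a ≤ a', hc' : c ≤ c'⟩ hS
        have hlt : x < a' := by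
          by_contra hle
          obtain ⟨_, w', hw', hw'r⟩ := haA ha
          refine hS ⟨⟨fun h => ⟨h, M.rho (s := ⟨a, y⟩) (t := ⟨a', y⟩) ⟨ha', le_rfl⟩ w', ?_, ?_⟩,
            not_lt.1 hle⟩, trivial⟩
          · rwa [rho_rho]
          · rwa [rho_rho]
        exact M.rho_eq_zero_of_le (r := ⟨a, c⟩) (s := ⟨x + 1, c⟩) (t := ⟨a', c'⟩) ⟨ha.trans hx1, le_rfl⟩
          ⟨hlt, hc'⟩ her
      · rw [← hwm, ← he, rho_rho]
    · rintro ⟨x', y'⟩ ⟨hx : x ≤ x', hy : y ≤ y'⟩ ⟨⟨-, hx' : x' ≤ x⟩, -⟩ hmem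
      obtain rfl := le_antisymm hx hx'
      obtain ⟨u, v, huv, hu, hv⟩ := exists_add_of_mem_imageOutside hmem
      have hv0 : v = 0 := hv.elim id fun ⟨b, h, _, hb, _⟩ => (hb trivial).elim
      rw [hv0, add_zero] at huv
      rcases hu with hu0 | ⟨a, ha, u₀, haX, hu₀⟩
      · exact hw₀ (hvert y' (y' - y).toNat y hy (by lia) m hmr (by rw [← huv, hu0]))
      · obtain ⟨z, hz, -⟩ := hM.exists_lift ha hy m u₀ (by rw [hu₀, huv])
        refine haX ⟨fun _ => ⟨ha, z, ?_, ?_⟩, ha⟩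
        · rwa [hz]
        · rw [← M.rho_rho (r := ⟨a, y⟩) (s := ⟨x, y⟩) (t := ⟨x + 1, y⟩) ⟨ha, le_rfl⟩ ⟨hx1, le_rfl⟩, hz,
            hmr]

/-- If all structure maps are injective, a nonzero vector yields a birth quadrant, possibly
unbounded to the left or below. Its left side is read off from the chain of horizontal images, its
lower side from the chain of vertical images inside the smallest nonzero horizontal one. -/
theorem exists_summandOn_birth (hpfd : M.IsPFD) (hM : M.IsExact)
    (hinj : ∀ (s t : Point ℤ) (h : s ≤ t) (m : M.obj s), M.rho h m = 0 → m = 0)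
    {x y : ℤ} {m₀ : M.obj ⟨x, y⟩} (hm₀ : m₀ ≠ 0) :
    ∃ X Y : Set ℤ, IsUpperSet X ∧ IsUpperSet Y ∧ x ∈ X ∧ y ∈ Y ∧
      Nonempty (M.SummandOn (prodSet X Y)) := by
  have hfin : FiniteDimensional k (M.obj ⟨x, y⟩) := hpfd _
  let W : {a // a ≤ x ∧ ∃ w : M.obj ⟨a, y⟩, w ≠ 0} → Submodule k (M.obj ⟨x, y⟩) := fun a =>
    LinearMap.range (M.rho (s := ⟨a, y⟩) (t := ⟨x, y⟩) ⟨a.2.1, le_rfl⟩)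
  have hW : ∀ a a', a ≤ a' → W a ≤ W a' := by
    rintro a a' h _ ⟨m, rfl⟩
    exact ⟨M.rho (s := ⟨a, y⟩) (t := ⟨a', y⟩) ⟨h, le_rfl⟩ m, M.rho_rho _ _ _⟩
  have : Nonempty {a // a ≤ x ∧ ∃ w : M.obj ⟨a, y⟩, w ≠ 0} := ⟨⟨x, le_rfl, m₀, hm₀⟩⟩
  obtain ⟨a₀, ha₀⟩ := exists_submodule_le_of_chain W fun a a' =>
    (le_total a a').imp (hW _ _) (hW _ _)
  let B : ℤ → Prop := fun b => ∃ h : b ≤ y,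
    LinearMap.range (M.rho (s := ⟨x, b⟩) (t := ⟨x, y⟩) ⟨le_rfl, h⟩) ⊓ W a₀ ≠ ⊥
  let V : {b // B b} → Submodule k (M.obj ⟨x, y⟩) := fun b =>
    LinearMap.range (M.rho (s := ⟨x, b⟩) (t := ⟨x, y⟩) ⟨le_rfl, b.2.1⟩) ⊓ W a₀
  have hrange : ∀ b b' (h : b ≤ b') (h' : b' ≤ y),
      LinearMap.range (M.rho (s := ⟨x, b⟩) (t := ⟨x, y⟩) ⟨le_rfl, h.trans h'⟩) ≤
        LinearMap.range (M.rho (s := ⟨x, b'⟩) (t := ⟨x, y⟩) ⟨le_rfl, h'⟩) := by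
    rintro b b' h h' _ ⟨m, rfl⟩
    exact ⟨M.rho (s := ⟨x, b⟩) (t := ⟨x, b'⟩) ⟨le_rfl, h⟩ m, M.rho_rho _ _ _⟩
  have hV : ∀ b b', b ≤ b' → V b ≤ V b' := fun b b' h =>
    inf_le_inf_right _ (hrange b b' h b'.2.1)
  have hBy : B y := by
    obtain ⟨w, hw⟩ := a₀.2.2
    refine ⟨le_rfl, fun h => hw (hinj ⟨a₀, y⟩ ⟨x, y⟩ ⟨a₀.2.1, le_rfl⟩ _ ?_)⟩
    exact (Submodule.eq_bot_iff _).1 h _ ⟨⟨_, M.rho_self _ _⟩, ⟨w, rfl⟩⟩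
  have : Nonempty {b // B b} := ⟨⟨y, hBy⟩⟩
  obtain ⟨b₀, hb₀⟩ := exists_submodule_le_of_chain V fun b b' =>
    (le_total b b').imp (hV _ _) (hV _ _)
  obtain ⟨m, hmV, hm⟩ := Submodule.exists_mem_ne_zero_of_ne_bot b₀.2.2
  have hXup : IsUpperSet {a | a ≤ x → ∃ w : M.obj ⟨a, y⟩, w ≠ 0} := by
    intro a b hab ha hb
    obtain ⟨w, hw⟩ := ha (hab.trans hb)
    exact ⟨M.rho (s := ⟨a, y⟩) (t := ⟨b, y⟩) ⟨hab, le_rfl⟩ w, fun h => hw (hinj _ _ _ _ h)⟩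
  have hYup : IsUpperSet {b | b ≤ y → B b} := by
    intro b b' hbb' hb hb'
    obtain ⟨h, hne⟩ := hb (hbb'.trans hb')
    exact ⟨hb', ne_bot_of_le_ne_bot hne (inf_le_inf_right _ (hrange b b' hbb' hb'))⟩
  refine ⟨_, _, hXup, hYup, fun _ => ⟨m, hm⟩, fun _ => hBy, ?_⟩
  refine M.exists_summandOn hpfd (directedOn_prodSet _ _) (codirectedOn_prodSet _ _)
    (p := ⟨x, y⟩) ⟨fun _ => ⟨m, hm⟩, fun _ => hBy⟩ m ?_ ?_
  · rintro ⟨a, b⟩ ⟨ha : a ≤ x, hb : b ≤ y⟩ ⟨haX, hbY⟩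
    obtain ⟨u, hu⟩ := ha₀ ⟨a, ha, haX ha⟩ hmV.2
    obtain ⟨v, hv⟩ := (hb₀ ⟨b, hbY hb⟩ hmV).1
    obtain ⟨e, -, he⟩ := hM.exists_lift ha hb v u (by rw [hu]; exact hv)
    refine ⟨e, mem_kernelOutside.2 fun t h ht => ?_, ?_⟩
    · exact (ht ⟨hXup h.1 haX, hYup h.2 hbY⟩).elim
    · rw [← hu, ← he, rho_rho]
  · rintro ⟨x', y'⟩ ⟨hx : x ≤ x', hy : y ≤ y'⟩ - hmem
    obtain ⟨u, v, huv, hu, hv⟩ := exists_add_of_mem_imageOutside hmem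
    -- Zero summands are put in the same form as the others, with source `x` resp. `y`.
    obtain ⟨a, ha, u₀, hau, hu₀⟩ : ∃ (a : ℤ) (h : a ≤ x) (u₀ : M.obj ⟨a, y'⟩),
        (u₀ = 0 ∨ ∀ w : M.obj ⟨a, y⟩, w = 0) ∧
          M.rho (s := ⟨a, y'⟩) (t := ⟨x', y'⟩) ⟨h.trans hx, le_rfl⟩ u₀ = u := by
      rcases hu with rfl | ⟨a, _, u₀, haX, hu₀⟩
      · exact ⟨x, le_rfl, 0, Or.inl rfl, map_zero _⟩
      · simp only [Set.mem_ofPred_eq, Classical.not_imp, not_exists, not_not] at haX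
        exact ⟨a, haX.1, u₀, Or.inr haX.2, hu₀⟩
    obtain ⟨b, hb, v₀, hbv, hv₀⟩ : ∃ (b : ℤ) (h : b ≤ y) (v₀ : M.obj ⟨x', b⟩),
        (v₀ = 0 ∨ ¬ B b) ∧
          M.rho (s := ⟨x', b⟩) (t := ⟨x', y'⟩) ⟨le_rfl, h.trans hy⟩ v₀ = v := by
      rcases hv with rfl | ⟨b, _, v₀, hbY, hv₀⟩
      · exact ⟨y, le_rfl, 0, Or.inl rfl, map_zero _⟩
      · simp only [Set.mem_ofPred_eq, Classical.not_imp] at hbY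
        exact ⟨b, hbY.1, v₀, Or.inr hbY.2, hv₀⟩
    -- Two lifts move the relation back to `⟨x, y⟩`: first `v₀` to `⟨x, b⟩`, then `u₀` to
    -- `⟨a, y⟩`, where it vanishes. So `m` is the image of `w`.
    obtain ⟨w, hwv, hwu⟩ := hM.exists_lift hx (hb.trans hy) v₀
      (M.rho (s := ⟨x, y⟩) (t := ⟨x, y'⟩) ⟨le_rfl, hy⟩ m -
        M.rho (s := ⟨a, y'⟩) (t := ⟨x, y'⟩) ⟨ha, le_rfl⟩ u₀) (by
      rw [map_sub, rho_rho, rho_rho, hv₀, hu₀, ← huv, add_sub_cancel_left])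
    obtain ⟨z, hz, hzu⟩ := hM.exists_lift ha hy
      (m - M.rho (s := ⟨x, b⟩) (t := ⟨x, y⟩) ⟨le_rfl, hb⟩ w) u₀ (by
      rw [map_sub, rho_rho, hwu, sub_sub_cancel])
    have hz0 : z = 0 := hau.elim (fun h => hinj _ _ _ z (hzu.trans h)) fun h => h z
    rw [hz0, map_zero, eq_comm, sub_eq_zero] at hz
    rcases hbv with h | h
    · exact hm (by rw [hz, hinj _ _ _ w (hwv.trans h), map_zero])
    · refine h ⟨hb, fun hbot => hm ((Submodule.eq_bot_iff _).1 hbot m ⟨⟨w, hz.symm⟩, hmV.2⟩)⟩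

/-- Maps that are injective one step to the right and one step upwards are all injective. -/
theorem rho_injective_of_succ
    (hr : ∀ (x y : ℤ) (m : M.obj ⟨x, y⟩),
      M.rho (s := ⟨x, y⟩) (t := ⟨x + 1, y⟩) ⟨(lt_add_one x).le, le_rfl⟩ m = 0 → m = 0)
    (hu : ∀ (x y : ℤ) (m : M.obj ⟨x, y⟩),
      M.rho (s := ⟨x, y⟩) (t := ⟨x, y + 1⟩) ⟨le_rfl, (lt_add_one y).le⟩ m = 0 → m = 0)
    (s t : Point ℤ) (h : s ≤ t) (m : M.obj s) (hm : M.rho h m = 0) : m = 0 := by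
  obtain ⟨n, hn⟩ : ∃ n : ℕ, t.x - s.x + (t.y - s.y) = n :=
    Int.eq_ofNat_of_zero_le (add_nonneg (sub_nonneg.2 h.1) (sub_nonneg.2 h.2))
  induction n generalizing s with
  | zero =>
    obtain rfl : s = t := Point.ext (by have := h.1; have := h.2; lia)
      (by have := h.1; have := h.2; lia)
    rwa [rho_self] at hm
  | succ n ih =>
    have h1 := h.1
    have h2 := h.2
    by_cases hx : s.x < t.x
    · refine hr _ _ m (ih ⟨s.x + 1, s.y⟩ ⟨hx, h.2⟩ _ ?_ ?_)
      · rwa [rho_rho]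
      · push_cast at hn ⊢; lia
    · refine hu _ _ m (ih ⟨s.x, s.y + 1⟩ ⟨h.1, show s.y < t.y by lia⟩ _ ?_ ?_)
      · rwa [rho_rho]
      · push_cast at hn ⊢; lia

theorem suppOn_death (x y : ℤ) :
    (Shape.mk .death (.up x) (.up y)).suppOn intToReal = prodSet (Set.Iic x) (Set.Iic y) :=
  Set.ext fun _ => and_congr Int.cast_le Int.cast_le

theorem suppOn_birth {d e : DecReal} {X Y : Set ℤ} (hd : ∀ z : ℤ, d.LeReal z ↔ z ∈ X)
    (he : ∀ z : ℤ, e.LeReal z ↔ z ∈ Y) :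
    (Shape.mk .birth d e).suppOn intToReal = prodSet X Y :=
  Set.ext fun t => and_congr (hd t.x) (he t.y)

theorem suppOn_vertical {d : DecReal} {X : Set ℤ} (hd : ∀ z : ℤ, d.LeReal z ↔ z ∈ X) (x : ℤ) :
    (Shape.mk .vertical d (.up x)).suppOn intToReal = prodSet (X ∩ Set.Iic x) Set.univ :=
  Set.ext fun t => (and_congr (hd t.x) Int.cast_le).trans (and_iff_left trivial).symm

theorem suppOn_horizontal {d : DecReal} {X : Set ℤ} (hd : ∀ z : ℤ, d.LeReal z ↔ z ∈ X) (x : ℤ) :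
    (Shape.mk .horizontal d (.up x)).suppOn intToReal =
      {t | ⟨t.y, t.x⟩ ∈ prodSet (X ∩ Set.Iic x) (Set.univ : Set ℤ)} :=
  Set.ext fun t => (and_congr (hd t.y) Int.cast_le).trans (and_iff_left trivial).symm

theorem exists_summandOn_block (hpfd : M.IsPFD) (hM : M.IsExact) {t : Point ℤ} {m : M.obj t}
    (hm : m ≠ 0) :
    ∃ F : Shape, (F.suppOn intToReal).Nonempty ∧ Nonempty (M.SummandOn (F.suppOn intToReal)) := by
  obtain ⟨x₀, y₀⟩ := t
  by_cases hdeath : ∀ (x y : ℤ) (m : M.obj ⟨x, y⟩),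
      M.rho (s := ⟨x, y⟩) (t := ⟨x + 1, y⟩) ⟨(lt_add_one x).le, le_rfl⟩ m = 0 →
      M.rho (s := ⟨x, y⟩) (t := ⟨x, y + 1⟩) ⟨le_rfl, (lt_add_one y).le⟩ m = 0 → m = 0
  swap
  · push Not at hdeath
    obtain ⟨x, y, m, hr, hu, hne⟩ := hdeath
    refine ⟨⟨.death, .up x, .up y⟩, ?_⟩
    rw [suppOn_death]
    exact ⟨⟨⟨x, y⟩, le_refl x, le_refl y⟩, exists_summandOn_death hpfd hM hne hr hu⟩
  by_cases hright : ∀ (x y : ℤ) (m : M.obj ⟨x, y⟩),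
      M.rho (s := ⟨x, y⟩) (t := ⟨x + 1, y⟩) ⟨(lt_add_one x).le, le_rfl⟩ m = 0 → m = 0
  swap
  · push Not at hright
    obtain ⟨x, y, m, hr, hne⟩ := hright
    obtain ⟨X, hX, hxX, hS⟩ := exists_summandOn_vertical hpfd hM hdeath hne hr
    obtain ⟨d, hd⟩ := DecReal.exists_leReal_iff hX
    refine ⟨⟨.vertical, d, .up x⟩, ?_⟩
    rw [suppOn_vertical hd]
    exact ⟨⟨⟨x, y⟩, ⟨hxX, le_refl x⟩, trivial⟩, hS⟩
  by_cases hup : ∀ (x y : ℤ) (m : M.obj ⟨x, y⟩),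
      M.rho (s := ⟨x, y⟩) (t := ⟨x, y + 1⟩) ⟨le_rfl, (lt_add_one y).le⟩ m = 0 → m = 0
  swap
  · push Not at hup
    obtain ⟨x, y, m, hu, hne⟩ := hup
    obtain ⟨X, hX, hyX, ⟨σ⟩⟩ := exists_summandOn_vertical (M := M.swap) (x := y) (y := x) (m₀ := m)
      (fun t => hpfd ⟨t.y, t.x⟩) hM.swap
      (fun x y m hr hu => hdeath y x m hu hr) hne hu
    obtain ⟨d, hd⟩ := DecReal.exists_leReal_iff hX
    refine ⟨⟨.horizontal, d, .up y⟩, ?_⟩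
    rw [suppOn_horizontal hd]
    exact ⟨⟨⟨x, y⟩, ⟨hyX, le_refl y⟩, trivial⟩, ⟨σ.ofSwap⟩⟩
  obtain ⟨X, Y, hX, hY, hxX, hyY, hS⟩ :=
    exists_summandOn_birth hpfd hM (rho_injective_of_succ hright hup) hm
  obtain ⟨d, hd⟩ := DecReal.exists_leReal_iff hX
  obtain ⟨e, he⟩ := DecReal.exists_leReal_iff hY
  refine ⟨⟨.birth, d, e⟩, ?_⟩
  rw [suppOn_birth hd he]
  exact ⟨⟨⟨x₀, y₀⟩, hxX, hyY⟩, hS⟩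

end Integers

end Bimodule

/-- Vectors `x i` and functionals `f i`, biorthogonal over the indices satisfying `p`, identify a
space spanned by those vectors with the direct sum of copies of `k` indexed by `p`. -/
theorem exists_linearEquiv_directSum_of_biorthogonal {k V I : Type*} [Field k] [AddCommGroup V]
    [Module k V] (p : I → Prop) (x : I → V) (f : I → V →ₗ[k] k) (hfx : ∀ i, p i → f i (x i) = 1)
    (horth : ∀ i j, i ≠ j → f i (x j) = 0) (hspan : Submodule.span k (x '' {i | p i}) = ⊤) :
    ∃ e : V ≃ₗ[k] ⨁ i, (PLift (p i) → k), ∀ v i (h : p i), e v i ⟨h⟩ = f i v := by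
  classical
  let incl : ∀ i, (PLift (p i) → k) →ₗ[k] V := fun i =>
    if h : p i then (LinearMap.proj ⟨h⟩ : (PLift (p i) → k) →ₗ[k] k).smulRight (x i) else 0
  have hincl : ∀ i (h : p i) (g : PLift (p i) → k), incl i g = g ⟨h⟩ • x i := fun i h g => by
    simp [incl, h]
  let L : (⨁ i, (PLift (p i) → k)) →ₗ[k] V := DirectSum.toModule k I V incl
  have hL : ∀ i g, L (DirectSum.lof k I (fun i => PLift (p i) → k) i g) = incl i g := fun i g =>
    DirectSum.toModule_lof (φ := incl) k i g
  have hfL : ∀ i (h : p i), f i ∘ₗ L = LinearMap.proj ⟨h⟩ ∘ₗ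
      DirectSum.component k I (fun i => PLift (p i) → k) i := by
    intro i h
    refine DirectSum.linearMap_ext k fun j => LinearMap.ext fun g => ?_
    simp only [LinearMap.comp_apply, hL, LinearMap.proj_apply]
    by_cases hij : i = j
    · subst hij
      rw [hincl i h, map_smul, hfx i h, DirectSum.component.lof_self, smul_eq_mul, mul_one]
    · rw [DirectSum.component.of, dif_neg (Ne.symm hij), Pi.zero_apply]
      by_cases hj : p j
      · rw [hincl j hj, map_smul, horth i j hij, smul_zero]
      · simp [incl, hj]
  have hbij : Function.Bijective L := by
    refine ⟨(injective_iff_map_eq_zero _).2 fun g hg => DFinsupp.ext fun i => ?_, ?_⟩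
    · funext ⟨h⟩
      have := LinearMap.congr_fun (hfL i h) g
      rw [LinearMap.comp_apply, hg, map_zero] at this
      exact this.symm
    · rw [← LinearMap.range_eq_top, eq_top_iff, ← hspan, Submodule.span_le]
      rintro _ ⟨i, h, rfl⟩
      refine ⟨DirectSum.lof k I (fun i => PLift (p i) → k) i fun _ => 1, ?_⟩
      rw [hL, hincl i h, one_smul]
  refine ⟨(LinearEquiv.ofBijective L hbij).symm, fun v i h => ?_⟩
  have := LinearMap.congr_fun (hfL i h) ((LinearEquiv.ofBijective L hbij).symm v)
  refine this.symm.trans (congrArg (f i) ?_)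
  exact (LinearEquiv.ofBijective L hbij).apply_symm_apply v

namespace Bimodule

/-! ### Orthogonal families of block summands -/

section Families

variable {k : Type u} [Field k] {M : Bimodule.{u, v, 0} ℤ k}

/-- The bimodule formed by subspaces that are stable under the structure maps. -/
noncomputable def sub (M : Bimodule.{u, v, 0} ℤ k) (A : ∀ t, Submodule k (M.obj t))
    (hA : ∀ s t (h : s ≤ t), A s ≤ (A t).comap (M.rho h)) : Bimodule.{u, v, 0} ℤ k where
  obj t := ModuleCat.of k (A t)
  map {s t} f := ModuleCat.ofHom ((M.rho (leOfHom f)).restrict (hA s t (leOfHom f)))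
  map_id t := by
    refine ModuleCat.hom_ext (LinearMap.ext fun m => Subtype.ext ?_)
    exact M.rho_self _ _
  map_comp {r s t} f g := by
    refine ModuleCat.hom_ext (LinearMap.ext fun m => Subtype.ext ?_)
    exact (M.rho_rho (leOfHom f) (leOfHom g) _).symm

variable (M) in
/-- A block summand of `M` whose block contains a point of `ℤ × ℤ`, together with the shape of its
block. -/
structure BlockSummand where
  shape : Shape
  nonempty : (shape.suppOn intToReal).Nonempty
  toSummandOn : M.SummandOn (shape.suppOn intToReal)

/-- The vectors of a block summand. -/
abbrev BlockSummand.elt (σ : M.BlockSummand) (t : Point ℤ) : M.obj t := σ.toSummandOn.elt t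

/-- The functionals of a block summand. -/
abbrev BlockSummand.func (σ : M.BlockSummand) (t : Point ℤ) : M.obj t →ₗ[k] k :=
  σ.toSummandOn.func t

/-- The block summands in `𝒮` are pairwise orthogonal: the functionals of each vanish on the vectors
of the others. -/
def Orthogonal (𝒮 : Set M.BlockSummand) : Prop :=
  𝒮.Pairwise fun σ τ => ∀ t, σ.func t (τ.elt t) = 0

/-- The members of `𝒮` whose block contains `t`. -/
def through (𝒮 : Set M.BlockSummand) (t : Point ℤ) : Set M.BlockSummand :=
  {σ | σ ∈ 𝒮 ∧ t ∈ σ.shape.suppOn intToReal}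

theorem Orthogonal.finite_through {𝒮 : Set M.BlockSummand} (h𝒮 : Orthogonal 𝒮) (hpfd : M.IsPFD)
    (t : Point ℤ) : (through 𝒮 t).Finite := by
  have : FiniteDimensional k (M.obj t) := hpfd t
  have hli : LinearIndependent k fun σ : through 𝒮 t => σ.1.elt t := by
    rw [linearIndependent_iff']
    intro s g hg σ hσ
    have h0 := congrArg (σ.1.func t) hg
    rw [map_sum, map_zero, Finset.sum_eq_single_of_mem σ hσ] at h0
    · rwa [map_smul, σ.1.toSummandOn.func_elt t σ.2.2, smul_eq_mul, mul_one] at h0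
    · intro τ _ hne
      rw [map_smul, h𝒮 σ.2.1 τ.2.1 (fun h => hne (Subtype.ext h.symm)), smul_zero]
  exact Set.finite_coe_iff.1 hli.finite

/-- The rank-one endomorphisms attached to a block summand commute with the structure maps. -/
theorem BlockSummand.rho_component (σ : M.BlockSummand) {s t : Point ℤ} (h : s ≤ t) (m : M.obj s) :
    M.rho h (σ.func s m • σ.elt s) = σ.func t (M.rho h m) • σ.elt t := by
  rw [map_smul]
  have hs : s ∉ σ.shape.suppOn intToReal → σ.func s m = 0 := fun hs => by
    rw [BlockSummand.func, σ.toSummandOn.func_off s hs, LinearMap.zero_apply]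
  by_cases ht : t ∈ σ.shape.suppOn intToReal
  · rw [BlockSummand.func, BlockSummand.func, σ.toSummandOn.func_rho s t h ht]
    by_cases hs' : s ∈ σ.shape.suppOn intToReal
    · rw [BlockSummand.elt, σ.toSummandOn.rho_elt s t h hs']
    · rw [show σ.toSummandOn.func s m = 0 from hs hs', zero_smul, zero_smul]
  · rw [show σ.elt t = 0 from σ.toSummandOn.elt_off t ht, smul_zero]
    by_cases hs' : s ∈ σ.shape.suppOn intToReal
    · rw [BlockSummand.elt, σ.toSummandOn.rho_elt s t h hs', σ.toSummandOn.elt_off t ht, smul_zero]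
    · rw [hs hs', zero_smul]

/-- The common kernel of the functionals of the block summands in `𝒮`. -/
def commonKernel (𝒮 : Set M.BlockSummand) (t : Point ℤ) : Submodule k (M.obj t) :=
  ⨅ σ ∈ 𝒮, LinearMap.ker (σ.func t)

theorem mem_commonKernel {𝒮 : Set M.BlockSummand} {t : Point ℤ} {m : M.obj t} :
    m ∈ commonKernel 𝒮 t ↔ ∀ σ ∈ 𝒮, σ.func t m = 0 := by
  simp [commonKernel, Submodule.mem_iInf]

theorem commonKernel_le_comap (𝒮 : Set M.BlockSummand) (s t : Point ℤ) (h : s ≤ t) :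
    commonKernel 𝒮 s ≤ (commonKernel 𝒮 t).comap (M.rho h) := by
  intro m hm
  rw [mem_commonKernel] at hm
  rw [Submodule.mem_comap, mem_commonKernel]
  intro σ hσ
  by_cases ht : t ∈ σ.shape.suppOn intToReal
  · rw [BlockSummand.func, σ.toSummandOn.func_rho s t h ht]
    exact hm σ hσ
  · rw [BlockSummand.func, σ.toSummandOn.func_off t ht, LinearMap.zero_apply]

/-- The projection onto the common kernel along the span of the vectors of the block summands. -/
noncomputable def Orthogonal.proj {𝒮 : Set M.BlockSummand} (h𝒮 : Orthogonal 𝒮) (hpfd : M.IsPFD)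
    (t : Point ℤ) : M.obj t →ₗ[k] M.obj t :=
  LinearMap.id - ∑ σ ∈ (h𝒮.finite_through hpfd t).toFinset, (σ.func t).smulRight (σ.elt t)

section Projection

variable {𝒮 : Set M.BlockSummand} (h𝒮 : Orthogonal 𝒮) (hpfd : M.IsPFD)
include h𝒮 hpfd

theorem Orthogonal.proj_apply {t : Point ℤ} (m : M.obj t) :
    h𝒮.proj hpfd t m =
      m - ∑ σ ∈ (h𝒮.finite_through hpfd t).toFinset, σ.func t m • σ.elt t := by
  simp [Orthogonal.proj, LinearMap.sum_apply]

theorem Orthogonal.proj_apply_of_subset {t : Point ℤ} {T : Finset M.BlockSummand} (hT : ↑T ⊆ 𝒮)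
    (hT' : through 𝒮 t ⊆ T) (m : M.obj t) :
    h𝒮.proj hpfd t m = m - ∑ σ ∈ T, σ.func t m • σ.elt t := by
  have hsub : (h𝒮.finite_through hpfd t).toFinset ⊆ T := by simpa using hT'
  rw [h𝒮.proj_apply hpfd, Finset.sum_subset hsub]
  intro σ hσ hσt
  have ht : t ∉ σ.shape.suppOn intToReal := fun ht =>
    hσt ((Set.Finite.mem_toFinset _).2 ⟨hT hσ, ht⟩)
  rw [BlockSummand.elt, σ.toSummandOn.elt_off t ht, smul_zero]

theorem Orthogonal.func_proj {t : Point ℤ} (m : M.obj t) {σ : M.BlockSummand} (hσ : σ ∈ 𝒮) :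
    σ.func t (h𝒮.proj hpfd t m) = 0 := by
  by_cases ht : t ∈ σ.shape.suppOn intToReal
  · rw [h𝒮.proj_apply hpfd, map_sub, map_sum,
      Finset.sum_eq_single_of_mem σ (by simpa using ⟨hσ, ht⟩), map_smul,
      σ.toSummandOn.func_elt t ht, smul_eq_mul, mul_one, sub_self]
    intro τ hτ hne
    simp only [Set.Finite.mem_toFinset] at hτ
    rw [map_smul, h𝒮 hσ hτ.1 hne.symm, smul_zero]
  · rw [BlockSummand.func, σ.toSummandOn.func_off t ht, LinearMap.zero_apply]

theorem Orthogonal.proj_mem {t : Point ℤ} (m : M.obj t) : h𝒮.proj hpfd t m ∈ commonKernel 𝒮 t :=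
  mem_commonKernel.2 fun _ hσ => h𝒮.func_proj hpfd m hσ

theorem Orthogonal.proj_of_mem {t : Point ℤ} {m : M.obj t} (hm : m ∈ commonKernel 𝒮 t) :
    h𝒮.proj hpfd t m = m := by
  rw [h𝒮.proj_apply hpfd, sub_eq_self]
  refine Finset.sum_eq_zero fun σ hσ => ?_
  simp only [Set.Finite.mem_toFinset] at hσ
  rw [mem_commonKernel.1 hm σ hσ.1, zero_smul]

theorem Orthogonal.proj_elt {t : Point ℤ} {σ : M.BlockSummand} (hσ : σ ∈ 𝒮) :
    h𝒮.proj hpfd t (σ.elt t) = 0 := by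
  by_cases ht : t ∈ σ.shape.suppOn intToReal
  · rw [h𝒮.proj_apply hpfd,
      Finset.sum_eq_single_of_mem σ (by simpa using ⟨hσ, ht⟩), σ.toSummandOn.func_elt t ht, one_smul,
      sub_self]
    intro τ hτ hne
    simp only [Set.Finite.mem_toFinset] at hτ
    rw [h𝒮 hτ.1 hσ hne, zero_smul]
  · rw [BlockSummand.elt, σ.toSummandOn.elt_off t ht, map_zero]

theorem Orthogonal.rho_proj {s t : Point ℤ} (h : s ≤ t) (m : M.obj s) :
    M.rho h (h𝒮.proj hpfd s m) = h𝒮.proj hpfd t (M.rho h m) := by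
  classical
  -- A finite set containing the summands through either point, so that the sums agree termwise.
  let T := (h𝒮.finite_through hpfd s).toFinset ∪ (h𝒮.finite_through hpfd t).toFinset
  have hT : ↑T ⊆ 𝒮 := fun σ hσ => by
    simp only [T, Finset.coe_union, Set.Finite.coe_toFinset] at hσ
    exact hσ.elim And.left And.left
  rw [h𝒮.proj_apply_of_subset hpfd hT (by simp [T]), h𝒮.proj_apply_of_subset hpfd hT (by simp [T]), map_sub,
    map_sum]
  simp only [BlockSummand.rho_component]

theorem Orthogonal.isExact_sub (hM : M.IsExact) :
    (M.sub (commonKernel 𝒮) (commonKernel_le_comap 𝒮)).IsExact := by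
  refine isExact_of_exists_lift fun {x x' y y'} hx hy b c hbc => ?_
  obtain ⟨a, hab, hac⟩ := hM.exists_lift hx hy b.1 c.1 (congrArg Subtype.val hbc)
  refine ⟨⟨h𝒮.proj hpfd _ a, h𝒮.proj_mem hpfd a⟩, Subtype.ext ?_, Subtype.ext ?_⟩
  · refine (h𝒮.rho_proj hpfd _ a).trans ?_
    rw [hab]
    exact h𝒮.proj_of_mem hpfd b.2
  · refine (h𝒮.rho_proj hpfd _ a).trans ?_
    rw [hac]
    exact h𝒮.proj_of_mem hpfd c.2

/-- A block summand of the common kernel, seen as a block summand of `M`. -/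
noncomputable def Orthogonal.liftSummand {S : Set (Point ℤ)}
    (σ : (M.sub (commonKernel 𝒮) (commonKernel_le_comap 𝒮)).SummandOn S) : M.SummandOn S where
  elt t := (σ.elt t : commonKernel 𝒮 t).1
  func t := σ.func t ∘ₗ (h𝒮.proj hpfd t).codRestrict (commonKernel 𝒮 t) (h𝒮.proj_mem hpfd)
  elt_off t ht := congrArg Subtype.val (σ.elt_off t ht)
  func_off t ht := LinearMap.ext fun m => LinearMap.congr_fun (σ.func_off t ht) _
  rho_elt s t h hs := congrArg Subtype.val (σ.rho_elt s t h hs)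
  func_rho s t h ht m := by
    refine Eq.trans (congrArg (σ.func t) (Subtype.ext ?_)) (σ.func_rho s t h ht _)
    exact (h𝒮.rho_proj hpfd h m).symm
  func_elt t ht := by
    refine Eq.trans (congrArg (σ.func t) (Subtype.ext ?_)) (σ.func_elt t ht)
    exact h𝒮.proj_of_mem hpfd (σ.elt t : commonKernel 𝒮 t).2

end Projection

/-- A maximal orthogonal set of block summands has common kernel zero: otherwise the common kernel,
being exact, would have a block summand, which could be added. -/
theorem exists_orthogonal_commonKernel_eq_bot (hpfd : M.IsPFD) (hM : M.IsExact) :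
    ∃ 𝒮 : Set M.BlockSummand, Orthogonal 𝒮 ∧ ∀ t, commonKernel 𝒮 t = ⊥ := by
  obtain ⟨𝒮, hmax⟩ := zorn_subset {𝒮 : Set M.BlockSummand | Orthogonal 𝒮} fun c hc hchain =>
    ⟨⋃₀ c, (Set.pairwise_sUnion hchain.directedOn).2 fun 𝒯 h𝒯 => hc h𝒯,
      fun _ h => Set.subset_sUnion_of_mem h⟩
  have h𝒮 : Orthogonal 𝒮 := hmax.prop
  refine ⟨𝒮, h𝒮, fun t => ?_⟩
  by_contra hne
  obtain ⟨m, hm, hm0⟩ := Submodule.exists_mem_ne_zero_of_ne_bot hne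
  have hfd : ∀ t, FiniteDimensional k (M.obj t) := hpfd
  obtain ⟨F, ⟨p, hp⟩, ⟨σ⟩⟩ := exists_summandOn_block
    (M := M.sub (commonKernel 𝒮) (commonKernel_le_comap 𝒮))
    (fun t => inferInstanceAs (FiniteDimensional k (commonKernel 𝒮 t)))
    (h𝒮.isExact_sub hpfd hM) (t := t) (m := (⟨m, hm⟩ : commonKernel 𝒮 t))
    (fun h => hm0 (congrArg Subtype.val h))
  let τ : M.BlockSummand := ⟨F, ⟨p, hp⟩, h𝒮.liftSummand hpfd σ⟩
  have h₁ : ∀ σ' ∈ 𝒮, ∀ t, σ'.func t (τ.elt t) = 0 := fun σ' hσ' t =>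
    mem_commonKernel.1 (σ.elt t : commonKernel 𝒮 t).2 σ' hσ'
  have h₂ : ∀ σ' ∈ 𝒮, ∀ t, τ.func t (σ'.elt t) = 0 := fun σ' hσ' t => by
    refine Eq.trans (congrArg (σ.func t) (Subtype.ext ?_)) (map_zero (σ.func t))
    exact h𝒮.proj_elt hpfd hσ'
  have hins : Orthogonal (insert τ 𝒮) :=
    h𝒮.insert fun σ' hσ' _ => ⟨fun t => h₂ σ' hσ' t, fun t => h₁ σ' hσ' t⟩
  have hτ : τ ∈ 𝒮 := hmax.le_of_ge hins (Set.subset_insert _ _) (Set.mem_insert _ _)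
  exact one_ne_zero ((τ.toSummandOn.func_elt p hp).symm.trans (h₁ τ hτ p))

/-! ### The decomposition -/

/-- This allows the summands to be indexed by a type in the lowest universe. -/
theorem Orthogonal.countable {𝒮 : Set M.BlockSummand} (h𝒮 : Orthogonal 𝒮) (hpfd : M.IsPFD) :
    𝒮.Countable := by
  have : Countable (Point ℤ) :=
    Function.Injective.countable (f := fun t : Point ℤ => (t.x, t.y)) fun s t h =>
      Point.ext (congrArg Prod.fst h) (congrArg Prod.snd h)
  refine (Set.countable_iUnion fun t => (h𝒮.finite_through hpfd t).countable).mono fun σ hσ => ?_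
  obtain ⟨t, ht⟩ := σ.nonempty
  exact Set.mem_iUnion.2 ⟨t, hσ, ht⟩

theorem blockModule_rho_of_mem {P : Type w} [PartialOrder P] (c : P →o ℝ) (F : Shape) {s t : Point P}
    (h : s ≤ t) (hs : s ∈ F.suppOn c) (ht : t ∈ F.suppOn c) (g : BlockSpace k (F.suppOn c) s) :
    ((blockModule k c F).rho h g : BlockSpace k (F.suppOn c) t) ⟨ht⟩ = g ⟨hs⟩ :=
  dif_pos (c := s ∈ F.suppOn c) hs

theorem blockModule_rho_of_notMem {P : Type w} [PartialOrder P] (c : P →o ℝ) (F : Shape)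
    {s t : Point P} (h : s ≤ t) (hs : s ∉ F.suppOn c) (ht : t ∈ F.suppOn c)
    (g : BlockSpace k (F.suppOn c) s) :
    ((blockModule k c F).rho h g : BlockSpace k (F.suppOn c) t) ⟨ht⟩ = 0 :=
  dif_neg (c := s ∈ F.suppOn c) hs

theorem isBlockDecomposable_int (hpfd : M.IsPFD) (hM : M.IsExact) :
    M.IsBlockDecomposable intToReal := by
  obtain ⟨𝒮, h𝒮, hker⟩ := exists_orthogonal_commonKernel_eq_bot hpfd hM
  have : Countable 𝒮 := (h𝒮.countable hpfd).to_subtype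
  have : Small.{0} 𝒮 := Countable.toSmall 𝒮
  let σ : Shrink.{0} 𝒮 → M.BlockSummand := fun i => ((equivShrink 𝒮).symm i).1
  have hσ𝒮 : ∀ i, σ i ∈ 𝒮 := fun i => ((equivShrink 𝒮).symm i).2
  have hspan : ∀ t, Submodule.span k
      ((fun i => (σ i).elt t) '' {i | t ∈ (σ i).shape.suppOn intToReal}) = ⊤ := by
    refine fun t => (Submodule.eq_top_iff'.2 fun m => ?_)
    have hproj : h𝒮.proj hpfd t m = 0 := by
      rw [← Submodule.mem_bot k, ← hker t]
      exact h𝒮.proj_mem hpfd m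
    rw [h𝒮.proj_apply hpfd, sub_eq_zero] at hproj
    rw [hproj]
    refine Submodule.sum_mem _ fun τ hτ => Submodule.smul_mem _ _ (Submodule.subset_span ?_)
    simp only [Set.Finite.mem_toFinset] at hτ
    obtain ⟨i, hi⟩ := (equivShrink 𝒮).symm.surjective ⟨τ, hτ.1⟩
    obtain rfl : σ i = τ := congrArg Subtype.val hi
    exact ⟨i, hτ.2, rfl⟩
  choose e he using fun t => exists_linearEquiv_directSum_of_biorthogonal
    (fun i => t ∈ (σ i).shape.suppOn intToReal) (fun i => (σ i).elt t) (fun i => (σ i).func t)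
    (fun i ht => (σ i).toSummandOn.func_elt t ht)
    (fun i j hij => h𝒮 (hσ𝒮 i) (hσ𝒮 j)
      (fun h => hij ((equivShrink 𝒮).symm.injective (Subtype.ext h))) t) (hspan t)
  refine ⟨Shrink.{0} 𝒮, fun i => (σ i).shape, e, fun s t h m i => ?_⟩
  funext ⟨ht⟩
  refine (he t _ i ht).trans (((σ i).toSummandOn.func_rho s t h ht m).trans ?_)
  by_cases hs : s ∈ (σ i).shape.suppOn intToReal
  · exact (he s m i hs).symm.trans (blockModule_rho_of_mem intToReal _ h hs ht _).symm
  · rw [(σ i).toSummandOn.func_off s hs]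
    exact (blockModule_rho_of_notMem intToReal _ h hs ht _).symm

end Families

theorem monotone_toNat : Monotone fun t : Point ℤ => (⟨t.x.toNat, t.y.toNat⟩ : Point ℕ) :=
  fun _ _ h => ⟨Int.toNat_le_toNat h.1, Int.toNat_le_toNat h.2⟩

theorem IsExact.pullback_toNat {k : Type u} [Field k] {M : Bimodule.{u, v, 0} ℕ k} (hM : M.IsExact) :
    (M.pullback _ monotone_toNat).IsExact :=
  isExact_of_exists_lift fun hx hy b c h =>
    hM.exists_lift (Int.toNat_le_toNat hx) (Int.toNat_le_toNat hy) b c h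

/-- The point of the plane `ℤ × ℤ` given by a point of `ℕ × ℕ`. -/
def intPoint (t : Point ℕ) : Point ℤ := ⟨t.x, t.y⟩

theorem intPoint_mem_suppOn (F : Shape) (t : Point ℕ) :
    intPoint t ∈ F.suppOn intToReal ↔ t ∈ F.suppOn natToReal := by
  simp [Shape.suppOn, intToReal, natToReal, intPoint]

/-- A bimodule over `ℕ` is the restriction of its pullback along the retraction of `ℤ` onto `ℕ`, so
the decomposition of the pullback restricts to it. -/
theorem isBlockDecomposable_nat {k : Type u} [Field k] {M : Bimodule.{u, v, 0} ℕ k} (hpfd : M.IsPFD)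
    (hM : M.IsExact) : M.IsBlockDecomposable natToReal := by
  obtain ⟨I, F, e, he⟩ := isBlockDecomposable_int (M := M.pullback _ monotone_toNat)
    (fun t => hpfd ⟨t.x.toNat, t.y.toNat⟩) hM.pullback_toNat
  let E : ∀ t i, (blockModule k intToReal (F i)).obj (intPoint t) ≃ₗ[k]
      (blockModule k natToReal (F i)).obj t := fun t i =>
    LinearEquiv.funCongrLeft k k
      (Equiv.plift.trans ((Equiv.ofIff (intPoint_mem_suppOn (F i) t).symm).trans Equiv.plift.symm))
  refine ⟨I, F, fun t => LinearEquiv.trans (e (intPoint t)) (DFinsupp.mapRange.linearEquiv (E t)),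
    fun s t h m i => ?_⟩
  have hst : intPoint s ≤ intPoint t := ⟨Int.ofNat_le.2 h.1, Int.ofNat_le.2 h.2⟩
  refine (congrArg (E t i) (he (intPoint s) (intPoint t) hst m i)).trans ?_
  funext ⟨ht⟩
  by_cases hs : s ∈ (F i).suppOn natToReal
  · exact (blockModule_rho_of_mem intToReal _ hst ((intPoint_mem_suppOn (F i) s).2 hs)
      ((intPoint_mem_suppOn (F i) t).2 ht) _).trans
      (blockModule_rho_of_mem natToReal _ h hs ht _).symm
  · exact (blockModule_rho_of_notMem intToReal _ hst (mt (intPoint_mem_suppOn (F i) s).1 hs)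
      ((intPoint_mem_suppOn (F i) t).2 ht) _).trans
      (blockModule_rho_of_notMem natToReal _ h hs ht _).symm

end Bimodule

theorem theorem6p10 (k : Type u) [Field k] :
    (∀ M : Bimodule.{u, v, 0} ℤ k, M.IsPFD → M.IsExact → M.IsBlockDecomposable intToReal) ∧
    (∀ M : Bimodule.{u, v, 0} ℕ k, M.IsPFD → M.IsExact → M.IsBlockDecomposable natToReal) :=
  ⟨fun _ hpfd hM => Bimodule.isBlockDecomposable_int hpfd hM,
    fun _ hpfd hM => Bimodule.isBlockDecomposable_nat hpfd hM⟩
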